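/- All matroids are finite. For a matroid $M$, write $r_M$ for its rank function, $M^*$ for its dual and $r^*_M$ for the rank function of $M^*$; $M$ is cosimple if $M^*$ is simple. For $n\ge 3$, a sequence $x_1,\dots,x_n,y_1,\dots,y_n$ of elements of a $3$-connected matroid $M$ is a carambole of $M$ if $y_1,\dots,y_n$ are distinct, $L=\{y_1,\dots,y_n\}$ is a line (a rank-$2$ flat) of $M$ such that the simplification $\mathrm{si}(M/L)$ is $3$-connected, and $(L\setminus\{y_i\})\cup\{x_i\}$ is a cocircuit of $M$ for each $i\in\{1,\dots,n\}$. For distinct elements $x_1,\dots,x_n,y_1,\dots,y_n$ with $X=\{x_1,\dots,x_n\}$ and $L=\{y_1,\dots,y_n\}$, let $\Theta_n$ be the matroid on $X\cup L$ whose circuits are: all $3$-element subsets of $X$; the sets $(L\setminus\{y_i\})\cup\{x_i\}$; and the sets $(L\setminus\{y_u\})\cup\{x_s,x_t\}$ with $s,t,u$ distinct. For matroids $M_1,M_2$ with $E(M_1)\cap E(M_2)=T$ and $M_1|T=M_2|T$ such that, for some $i\in\{1,2\}$, $\mathrm{cl}_{M_i}(T)$ is a modular flat of $M_i$ each of whose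 elements outside $T$ is a loop or is parallel to an element of $T$, the generalized parallel connection $P_T(M_1,M_2)$ is the matroid on $E(M_1)\cup E(M_2)$ whose flats are the sets $F$ such that $F\cap E(M_i)$ is a flat of $M_i$ for $i=1,2$. Let $n\ge 3$, $X=\{x_1,\dots,x_n\}$ and $L=\{y_1,\dots,y_n\}$. Suppose that $H$ is a cosimple matroid with $X\subseteq E(H)$, $r^*_H(X)=2$ and $L\cap E(H)=\emptyset$, and that $M$ is a $3$-connected simple matroid having $x_1,\dots,x_n,y_1,\dots,y_n$ as a carambole. Then the $2n$ elements $x_1,\dots,x_n,y_1,\dots,y_n$ are distinct, and $H=M/L$ if and only if $M^*=P_X(H^*,\Theta_n)$ (the right-hand side including that this generalized parallel connection is defined). -/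

import Mathlib

namespace Matroid

variable {α : Type*}

/-- A matroid is simple if it has neither loops nor parallel pairs,
i.e. all its circuits have at least three elements. -/
def IsSimple (M : Matroid α) : Prop :=
  ∀ C, M.IsCircuit C → 3 ≤ C.encard

/-- A matroid is cosimple if its dual is simple. -/
def IsCosimple (M : Matroid α) : Prop := M✶.IsSimple

/-- `A` and its complement form a (Tutte) `k`-separation of `M`: both sides have at least `k`
elements and `r(A) + r(E - A) - r(M) < k`. -/
def IsSeparation (M : Matroid α) (k : ℕ) (A : Set α) : Prop :=
  A ⊆ M.E ∧ (k : ℕ∞) ≤ A.encard ∧ (k : ℕ∞) ≤ (M.E \ A).encard ∧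
    M.eRk A + M.eRk (M.E \ A) < M.eRank + k

/-- `M` is 3-connected: it has no `1`-separation and no `2`-separation. -/
def IsThreeConnected (M : Matroid α) : Prop :=
  ∀ k : ℕ, 1 ≤ k → k < 3 → ∀ A, ¬ M.IsSeparation k A

/-- `N` is a simplification `si(M)` of `M`: it is obtained from `M` by deleting all loops and
all but one element of every parallel class. (Any two simplifications are isomorphic.) -/
def IsSimplification (N M : Matroid α) : Prop :=
  ∃ S : Set α, (∀ e ∈ S, M.IsNonloop e) ∧
    (∀ e, M.IsNonloop e → ∃! f, f ∈ S ∧ M.closure {e} = M.closure {f}) ∧ N = M ↾ S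

/-- `Y` is vertically contractible in `M`: `si(M / Y)` is 3-connected. -/
def IsVerticallyContractible (M : Matroid α) (Y : Set α) : Prop :=
  Y ⊆ M.E ∧ ∃ N : Matroid α, N.IsSimplification (M ／ Y) ∧ N.IsThreeConnected

/-- A line is a flat of rank two. -/
def IsLine (M : Matroid α) (L : Set α) : Prop := M.IsFlat L ∧ M.eRk L = 2

/-- The sequence `x₁, …, xₙ, y₁, …, yₙ` is a carambole of `M`. -/
structure IsCarambole (M : Matroid α) {n : ℕ} (x y : Fin n → α) : Prop where
  three_le : 3 ≤ n
  injective : Function.Injective y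
  isLine : M.IsLine (Set.range y)
  contractible : M.IsVerticallyContractible (Set.range y)
  isCocircuit : ∀ i, M.IsCocircuit (insert (x i) (Set.range y \ {y i}))

/-- `F` is a modular flat of `M`. -/
def IsModularFlat (M : Matroid α) (F : Set α) : Prop :=
  M.IsFlat F ∧ ∀ G, M.IsFlat G → M.eRk F + M.eRk G = M.eRk (F ∪ G) + M.eRk (F ∩ G)

/-- The condition on one of the parts under which generalized parallel connections across `T` are
defined: the closure of `T` is a modular flat, and every element of it outside `T` is a loop or
parallel to an element of `T`. -/
def IsModularlyEmbedded (M : Matroid α) (T : Set α) : Prop :=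
  M.IsModularFlat (M.closure T) ∧
    ∀ e ∈ M.closure T \ T, M.IsLoop e ∨ ∃ f ∈ T, M.IsNonloop f ∧ M.closure {e} = M.closure {f}

/-- `P = P_T(M₁, M₂)`: the generalized parallel connection of `M₁` and `M₂` across `T` is defined,
and `P` is the matroid on `E(M₁) ∪ E(M₂)` whose flats are the sets that
meet `E(M₁)` in a flat of `M₁` and `E(M₂)` in a flat of `M₂`. -/
structure IsGenParallelConnection (P : Matroid α) (T : Set α) (M₁ M₂ : Matroid α) : Prop where
  inter_eq : M₁.E ∩ M₂.E = T
  restrict_eq : M₁ ↾ T = M₂ ↾ T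
  modular : M₁.IsModularlyEmbedded T ∨ M₂.IsModularlyEmbedded T
  ground_eq : P.E = M₁.E ∪ M₂.E
  isFlat_iff : ∀ F ⊆ P.E, P.IsFlat F ↔ M₁.IsFlat (F ∩ M₁.E) ∧ M₂.IsFlat (F ∩ M₂.E)

/-- There is at most one generalized parallel connection. -/
theorem IsGenParallelConnection.unique {P Q M₁ M₂ : Matroid α} {T : Set α}
    (hP : P.IsGenParallelConnection T M₁ M₂) (hQ : Q.IsGenParallelConnection T M₁ M₂) : P = Q := by
  have hE : P.E = Q.E := hP.ground_eq.trans hQ.ground_eq.symm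
  have hF : ∀ F, P.IsFlat F ↔ Q.IsFlat F := by
    intro F
    by_cases h : F ⊆ P.E
    · rw [hP.isFlat_iff F h, hQ.isFlat_iff F (hE ▸ h)]
    · exact ⟨fun h' => absurd h'.subset_ground h,
        fun h' => absurd (hE ▸ h'.subset_ground) h⟩
  refine ext_closure fun X => ?_
  simp only [closure, hE, hF]

/-- The circuits of `Θₙ`; the index `Sum.inl i` stands for `xᵢ` and `Sum.inr i` for `yᵢ`. -/
def thetaCircuits (n : ℕ) : Set (Set (Fin n ⊕ Fin n)) :=
  {C | (∃ i j k, i ≠ j ∧ i ≠ k ∧ j ≠ k ∧ C = {Sum.inl i, Sum.inl j, Sum.inl k}) ∨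
    (∃ i, C = insert (Sum.inl i) (Sum.inr '' {i}ᶜ)) ∨
    (∃ s t u, s ≠ t ∧ s ≠ u ∧ t ≠ u ∧ C = {Sum.inl s, Sum.inl t} ∪ Sum.inr '' {u}ᶜ)}

def ThetaP {n : ℕ} (A B : Finset (Fin n)) : Prop :=
  A.card ≤ 2 ∧ A.card + B.card ≤ n ∧ ∀ i, ¬ (A = {i} ∧ B = {i}ᶜ)

theorem theta_card_compl {n : ℕ} (i : Fin n) : ({i}ᶜ : Finset (Fin n)).card + 1 = n := by
  have := Finset.card_add_card_compl ({i} : Finset (Fin n))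
  simp only [Finset.card_singleton, Fintype.card_fin] at this
  omega

theorem theta_eq_compl {n : ℕ} {i : Fin n} {B : Finset (Fin n)} (hi : i ∉ B)
    (hB : n ≤ B.card + 1) : B = {i}ᶜ := by
  refine Finset.eq_of_subset_of_card_le ?_ ?_
  · intro b hb
    simp only [Finset.mem_compl, Finset.mem_singleton]
    rintro rfl
    exact hi hb
  · have := theta_card_compl i
    omega

open Classical in
theorem thetaP_iff {n : ℕ} (I : Set (Fin n ⊕ Fin n)) :
    (∀ C ∈ thetaCircuits n, ¬ C ⊆ I) ↔
      ThetaP (Finset.univ.filter fun i => Sum.inl i ∈ I)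
        (Finset.univ.filter fun i => Sum.inr i ∈ I) := by
  set A := Finset.univ.filter fun i => Sum.inl i ∈ I with hA
  set B := Finset.univ.filter fun i => Sum.inr i ∈ I with hB
  have mA : ∀ i, Sum.inl i ∈ I ↔ i ∈ A := by simp [hA]
  have mB : ∀ i, Sum.inr i ∈ I ↔ i ∈ B := by simp [hB]
  have sB : ∀ u, Sum.inr '' ({u}ᶜ : Set (Fin n)) ⊆ I ↔ ({u}ᶜ : Finset (Fin n)) ⊆ B := by
    intro u
    simp [Set.subset_def, Finset.subset_iff, ← mB]
  constructor
  · intro h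
    have h1 : ∀ i j k, i ≠ j → i ≠ k → j ≠ k → i ∈ A → j ∈ A → k ∉ A := by
      intro i j k hij hik hjk hi hj hk
      refine h _ (Or.inl ⟨i, j, k, hij, hik, hjk, rfl⟩) ?_
      simp [Set.insert_subset_iff, mA, hi, hj, hk]
    have h2 : ∀ i, i ∈ A → ¬ ({i}ᶜ : Finset (Fin n)) ⊆ B := by
      intro i hi hB
      refine h _ (Or.inr (Or.inl ⟨i, rfl⟩)) ?_
      rw [Set.insert_subset_iff, mA, sB]
      exact ⟨hi, hB⟩
    have h3 : ∀ s t u, s ≠ t → s ≠ u → t ≠ u → s ∈ A → t ∈ A →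
        ¬ ({u}ᶜ : Finset (Fin n)) ⊆ B := by
      intro s t u hst hsu htu hs ht hB
      refine h _ (Or.inr (Or.inr ⟨s, t, u, hst, hsu, htu, rfl⟩)) ?_
      rw [Set.union_subset_iff, sB]
      simp [Set.insert_subset_iff, mA, hs, ht, hB]
    have hA2 : A.card ≤ 2 := by
      by_contra hc
      obtain ⟨i, j, k, hi, hj, hk, hij, hik, hjk⟩ := Finset.two_lt_card_iff.1 (not_le.1 hc)
      exact h1 i j k hij hik hjk hi hj hk
    refine ⟨hA2, ?_, ?_⟩
    · by_contra hc
      have hBn : B.card ≤ n := by simpa using Finset.card_le_univ B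
      by_cases hu : ∃ u, u ∉ B
      · obtain ⟨u, hu⟩ := hu
        have hBu := theta_eq_compl hu (by omega)
        have := theta_card_compl u
        rw [← hBu] at this
        obtain ⟨s, t, hst, hAst⟩ := Finset.card_eq_two.1 (show A.card = 2 by omega)
        by_cases hsu : s = u
        · exact h2 s (by simp [hAst]) (by rw [hsu, hBu])
        by_cases htu : t = u
        · exact h2 t (by simp [hAst]) (by rw [htu, hBu])
        exact h3 s t u hst hsu htu (by simp [hAst]) (by simp [hAst]) hBu.ge
      · push Not at hu
        have : 0 < A.card := by omega
        obtain ⟨i, hi⟩ := Finset.card_pos.1 this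
        exact h2 i hi fun b _ => hu b
    · rintro i ⟨hi, hB⟩
      exact h2 i (by simp [hi]) hB.ge
  · rintro ⟨h1, h2, h3⟩ C (⟨i, j, k, hij, hik, hjk, rfl⟩ | ⟨i, rfl⟩ |
      ⟨s, t, u, hst, hsu, htu, rfl⟩) hC
    · simp only [Set.insert_subset_iff, Set.singleton_subset_iff, mA] at hC
      have := Finset.two_lt_card_iff.2 ⟨i, j, k, hC.1, hC.2.1, hC.2.2, hij, hik, hjk⟩
      omega
    · rw [Set.insert_subset_iff, mA, sB] at hC
      have c := theta_card_compl i
      have c1 := Finset.card_le_card hC.2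
      have c2 := Finset.card_le_card (Finset.singleton_subset_iff.2 hC.1)
      rw [Finset.card_singleton] at c2
      refine h3 i ⟨(Finset.eq_of_subset_of_card_le (Finset.singleton_subset_iff.2 hC.1) ?_).symm,
        (Finset.eq_of_subset_of_card_le hC.2 ?_).symm⟩
      · rw [Finset.card_singleton]; omega
      · omega
    · rw [Set.union_subset_iff, sB] at hC
      simp only [Set.insert_subset_iff, Set.singleton_subset_iff, mA] at hC
      have c := theta_card_compl u
      have c1 := Finset.card_le_card hC.2
      have := Finset.one_lt_card_iff.2 ⟨s, t, hC.1.1, hC.1.2, hst⟩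
      omega

theorem ThetaP.aug {n : ℕ} {A B A' B' : Finset (Fin n)} (h : ThetaP A B)
    (h' : ThetaP A' B') (hlt : A.card + B.card < A'.card + B'.card) :
    (∃ a ∈ A', a ∉ A ∧ ThetaP (insert a A) B) ∨ (∃ b ∈ B', b ∉ B ∧ ThetaP A (insert b B)) := by
  obtain ⟨h1, h2, h3⟩ := h
  obtain ⟨h1', h2', h3'⟩ := h'
  have bad : ∀ {A B : Finset (Fin n)} {i}, A = {i} ∧ B = {i}ᶜ → A.card = 1 ∧ B.card + 1 = n := by
    rintro A B i ⟨rfl, rfl⟩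
    exact ⟨by simp, theta_card_compl i⟩
  have exB : B.card < B'.card → ∃ b ∈ B', b ∉ B := Finset.exists_mem_notMem_of_card_lt_card
  by_cases hA2 : A.card = 2
  · obtain ⟨b, hb, hbB⟩ := exB (by omega)
    refine Or.inr ⟨b, hb, hbB, h1, ?_, fun i hi => ?_⟩
    · rw [Finset.card_insert_of_notMem hbB]; omega
    · have := bad hi; omega
  by_cases hn : A.card + B.card + 2 ≤ n
  · by_cases ha : ∃ a ∈ A', a ∉ A
    · obtain ⟨a, ha, haA⟩ := ha
      have hc := Finset.card_insert_of_notMem haA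
      refine Or.inl ⟨a, ha, haA, by omega, by omega, fun i hi => ?_⟩
      have := bad hi; omega
    · push Not at ha
      have := Finset.card_le_card (show A' ⊆ A from ha)
      obtain ⟨b, hb, hbB⟩ := exB (by omega)
      have hc := Finset.card_insert_of_notMem hbB
      refine Or.inr ⟨b, hb, hbB, by omega, by omega, fun i hi => ?_⟩
      have := bad hi; omega
  by_cases hA1 : A.card = 1
  · by_cases ha : ∃ a ∈ A', a ∉ A
    · obtain ⟨a, ha, haA⟩ := ha
      have hc := Finset.card_insert_of_notMem haA
      refine Or.inl ⟨a, ha, haA, by omega, by omega, fun i hi => ?_⟩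
      have := bad hi; omega
    push Not at ha
    have hsub : A' ⊆ A := ha
    have hcA := Finset.card_le_card hsub
    obtain ⟨i, rfl⟩ := Finset.card_eq_one.1 hA1
    obtain ⟨b, hb, hbB⟩ := exB (by omega)
    have key : ∀ b ∉ B, insert b B ≠ {i}ᶜ → ThetaP {i} (insert b B) := by
      intro b hb hne
      have hc := Finset.card_insert_of_notMem hb
      refine ⟨by omega, by omega, ?_⟩
      rintro j ⟨hj, hj'⟩
      rw [Finset.singleton_inj] at hj
      subst hj
      exact hne hj'
    by_cases hne : insert b B = {i}ᶜ
    · have hiB : i ∉ B := fun hi => by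
        have : i ∈ insert b B := Finset.mem_insert_of_mem hi
        rw [hne] at this
        simp at this
      by_cases hiB' : i ∈ B'
      · refine Or.inr ⟨i, hiB', hiB, key i hiB fun h => ?_⟩
        have : i ∈ insert i B := Finset.mem_insert_self _ _
        rw [h] at this
        simp at this
      · exfalso
        have e := theta_eq_compl hiB' (by omega)
        have c := theta_card_compl i
        rw [← e] at c
        exact h3' i ⟨Finset.eq_of_subset_of_card_le hsub (by omega), e⟩
    · exact Or.inr ⟨b, hb, hbB, key b hbB hne⟩
  have hA0 : A.card = 0 := by omega
  obtain rfl := Finset.card_eq_zero.1 hA0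
  by_cases hb : ∃ b ∈ B', b ∉ B
  · obtain ⟨b, hb, hbB⟩ := hb
    have hc := Finset.card_insert_of_notMem hbB
    refine Or.inr ⟨b, hb, hbB, by omega, by omega, fun i hi => ?_⟩
    have := bad hi; omega
  push Not at hb
  have hsub : B' ⊆ B := hb
  have hcB := Finset.card_le_card hsub
  have key : ∀ a, B ≠ {a}ᶜ → ThetaP (insert a ∅) B := by
    intro a hne
    refine ⟨by simp, by simp only [Finset.card_insert_of_notMem (Finset.notMem_empty a)]; omega, ?_⟩
    rintro j ⟨hj, hj'⟩
    have : a = j := by simpa using hj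
    subst this
    exact hne hj'
  obtain ⟨a, ha⟩ := Finset.card_pos.1 (show 0 < A'.card by omega)
  by_cases hBa : B = {a}ᶜ
  · by_cases hex : ∃ c ∈ A', c ≠ a
    · obtain ⟨c, hc, hca⟩ := hex
      refine Or.inl ⟨c, hc, by simp, key c fun h => hca ?_⟩
      have := hBa.symm.trans h
      simpa using this.symm
    · exfalso
      push Not at hex
      have hA' : A' = {a} := Finset.eq_singleton_iff_unique_mem.2 ⟨ha, hex⟩
      subst hA'
      simp only [Finset.card_singleton, Finset.card_empty] at *
      exact h3' a ⟨rfl, (Finset.eq_of_subset_of_card_le hsub (by omega)).trans hBa⟩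
  · exact Or.inl ⟨a, ha, by simp, key a hBa⟩

open Classical in
theorem theta_ncard_eq {n : ℕ} (I : Set (Fin n ⊕ Fin n)) :
    I.ncard = (Finset.univ.filter fun i => Sum.inl i ∈ I).card +
      (Finset.univ.filter fun i => Sum.inr i ∈ I).card := by
  have h : I = ((Finset.univ.filter fun i => Sum.inl i ∈ I).disjSum
      (Finset.univ.filter fun i => Sum.inr i ∈ I) : Finset (Fin n ⊕ Fin n)) := by
    ext (i | i) <;> simp
  conv_lhs => rw [h]
  rw [Set.ncard_coe_finset, Finset.card_disjSum]

/-- The matroid `Θₙ` on the `2n` labels of `x₁, …, xₙ, y₁, …, yₙ`: a set is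
independent if and only if it contains none of the sets in `thetaCircuits n`. -/
def theta (n : ℕ) : Matroid (Fin n ⊕ Fin n) :=
  (IndepMatroid.ofFinite (E := Set.univ) Set.finite_univ
    (Indep := fun I => ∀ C ∈ thetaCircuits n, ¬ C ⊆ I)
    (indep_empty := by
      rw [thetaP_iff]
      refine ⟨by simp, by simp, ?_⟩
      rintro i ⟨h, -⟩
      have : i ∈ ({i} : Finset (Fin n)) := Finset.mem_singleton_self i
      rw [← h] at this
      simp at this)
    (indep_subset := fun _ _ hJ hIJ C hC hCI => hJ C hC (hCI.trans hIJ))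
    (indep_aug := by
      classical
      intro I J hI hJ hlt
      rw [theta_ncard_eq, theta_ncard_eq] at hlt
      rw [thetaP_iff] at hI hJ
      rcases hI.aug hJ hlt with ⟨a, ha, haI, h⟩ | ⟨a, ha, haI, h⟩
      · refine ⟨Sum.inl a, by simpa using ha, by simpa using haI, ?_⟩
        rw [thetaP_iff]
        convert h using 1
        · ext i; simp
        · ext i; simp
      · refine ⟨Sum.inr a, by simpa using ha, by simpa using haI, ?_⟩
        rw [thetaP_iff]
        convert h using 1
        · ext i; simp
        · ext i; simp)
    (subset_ground := fun _ _ => Set.subset_univ _)).matroid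

theorem theta_indep_iff {n : ℕ} {I : Set (Fin n ⊕ Fin n)} :
    (theta n).Indep I ↔ ∀ C ∈ thetaCircuits n, ¬ C ⊆ I := Iff.rfl

theorem thetaCircuits_antichain {n : ℕ} {C D : Set (Fin n ⊕ Fin n)} (hC : C ∈ thetaCircuits n)
    (hD : D ∈ thetaCircuits n) (h : C ⊆ D) : C = D := by
  have hl : ∀ i, Sum.inl i ∈ C → Sum.inl i ∈ D := fun i hi => h hi
  have hr : ∀ i, Sum.inr i ∈ C → Sum.inr i ∈ D := fun i hi => h hi
  clear h
  rcases hC with ⟨i, j, k, hij, hik, hjk, rfl⟩ | ⟨i, rfl⟩ | ⟨s, t, u, hst, hsu, htu, rfl⟩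
  · have h1 := hl i (by simp)
    have h2 := hl j (by simp)
    have h3 := hl k (by simp)
    rcases hD with ⟨i', j', k', hij', hik', hjk', rfl⟩ | ⟨i', rfl⟩ |
      ⟨s', t', u', hst', hsu', htu', rfl⟩ <;> simp at h1 h2 h3
    · clear hl hr
      ext (a | a) <;> simp
      grind
    · grind
    · grind
  · have h1 := hl i (by simp)
    have h2 : ∀ a, a ≠ i → Sum.inr a ∈ D := fun a ha => hr a (by simpa using ha)
    rcases hD with ⟨i', j', k', hij', hik', hjk', rfl⟩ | ⟨i', rfl⟩ |
      ⟨s', t', u', hst', hsu', htu', rfl⟩ <;> simp at h1 h2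
    · have := h2 i'
      have := h2 j'
      grind
    · rw [h1]
    · grind
  · have h1 := hl s (by simp)
    have h3 := hl t (by simp)
    have h2 : ∀ a, a ≠ u → Sum.inr a ∈ D := fun a ha => hr a (by simpa using ha)
    rcases hD with ⟨i', j', k', hij', hik', hjk', rfl⟩ | ⟨i', rfl⟩ |
      ⟨s', t', u', hst', hsu', htu', rfl⟩ <;> simp at h1 h2 h3
    · exact absurd (h2 s) (by simpa using hsu)
    · grind
    · have hu : u = u' := by
        by_contra hne
        exact h2 u' (Ne.symm hne) rfl
      subst hu
      clear hl hr
      ext (a | a) <;> simp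
      grind

/-- The circuits of `theta n` are the members of `thetaCircuits n`. -/
theorem theta_isCircuit_iff {n : ℕ} {C : Set (Fin n ⊕ Fin n)} :
    (theta n).IsCircuit C ↔ C ∈ thetaCircuits n := by
  have hdep : ∀ D, (theta n).Dep D ↔ ∃ C ∈ thetaCircuits n, C ⊆ D := by
    intro D
    rw [Dep, theta_indep_iff]
    push Not
    exact ⟨fun h => h.1, fun h => ⟨h, Set.subset_univ D⟩⟩
  constructor
  · intro h
    obtain ⟨D, hD, hDC⟩ := (hdep C).1 h.prop
    rwa [← h.eq_of_subset ((hdep D).2 ⟨D, hD, subset_rfl⟩) hDC]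
  · intro h
    refine ⟨(hdep C).2 ⟨C, h, subset_rfl⟩, fun D hD hDC => ?_⟩
    obtain ⟨D', hD', hD'D⟩ := (hdep D).1 hD
    rwa [← thetaCircuits_antichain hD' h (hD'D.trans hDC)]

/-- The copy of `Θₙ` on `{x₁, …, xₙ} ∪ {y₁, …, yₙ}`, where these `2n` elements are distinct. -/
def thetaOn {n : ℕ} (x y : Fin n → α) (h : Function.Injective (Sum.elim x y)) : Matroid α :=
  (theta n).map (Sum.elim x y) h.injOn

end Matroid

/-! Work in `N = M✶`, where the carambole becomes an independent set `L` and `n` circuits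
`(L \ {yᵢ}) ∪ {xᵢ}`. As `L` has rank at most two in `M`, submodularity of `r_N` applied to `cl(L)`
and `E \ L` gives `r_N(X) ≤ 2`. This determines `N ↾ (X ∪ L)`: it is `Θₙ`, in which `X` is a
modular line, and `E \ L` and `X ∪ L` are a modular pair of `N`. For a modular pair `(A, B)`
covering `N` with `A ∩ B` modular in `N ↾ B`, a set is a flat of `N` as soon as its traces on `A`
and `B` are flats of the restrictions, which is to say that `N` is their generalized parallel
connection. So `M✶ = P_X((M ／ L)✶, Θₙ)`. Conversely, deleting from a generalized parallel
connection the elements outside one part recovers that part. -/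

open Set Matroid

section Flats

variable {α : Type*} {N N' : Matroid α} {A F : Set α}

theorem eq_of_forall_isFlat_iff (h : ∀ F, N.IsFlat F ↔ N'.IsFlat F) : N = N' := by
  have hE : N.E = N'.E := ((h _).1 N.ground_isFlat).subset_ground.antisymm
    ((h _).2 N'.ground_isFlat).subset_ground
  refine ext_closure fun X => ?_
  simp only [Matroid.closure, h, hE]

theorem isFlat_restrict_iff (hA : A ⊆ N.E) (hF : F ⊆ A) :
    (N ↾ A).IsFlat F ↔ N.closure F ∩ A = F := by
  rw [isFlat_iff_closure_eq, restrict_closure_eq _ hF hA]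

theorem isFlat_restrict_inter (hF : N.IsFlat F) (hA : A ⊆ N.E) : (N ↾ A).IsFlat (F ∩ A) := by
  rw [isFlat_restrict_iff hA inter_subset_right]
  refine subset_antisymm (inter_subset_inter_left _ ?_) (subset_inter ?_ inter_subset_right)
  · exact (N.closure_subset_closure inter_subset_left).trans hF.closure.subset
  · exact N.subset_closure _ (inter_subset_right.trans hA)

end Flats

/-- `A` and `B` form a modular pair of `N`: submodularity of the rank function holds with equality
for them. The rank is the `ℕ∞`-valued `eRk`, so this says little about sets of infinite rank. -/
def IsModularPair {α : Type*} (N : Matroid α) (A B : Set α) : Prop :=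
  N.eRk A + N.eRk B = N.eRk (A ∪ B) + N.eRk (A ∩ B)

namespace IsModularPair

variable {α : Type*} {N : Matroid α} {A B F G I K R S : Set α}

theorem of_le (h : N.eRk A + N.eRk B ≤ N.eRk (A ∪ B) + N.eRk (A ∩ B)) : IsModularPair N A B :=
  h.antisymm ((add_comm _ _).trans_le (N.eRk_inter_add_eRk_union_le A B))

theorem symm (h : IsModularPair N A B) : IsModularPair N B A := by
  rwa [IsModularPair, add_comm, union_comm, inter_comm]

theorem of_subset (h : A ⊆ B) : IsModularPair N A B := by
  rw [IsModularPair, union_eq_right.2 h, inter_eq_left.2 h, add_comm]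

theorem restrict_iff (hA : A ⊆ R) (hB : B ⊆ R) :
    IsModularPair (N ↾ R) A B ↔ IsModularPair N A B := by
  rw [IsModularPair, restrict_eRk_eq _ hA, restrict_eRk_eq _ hB,
    restrict_eRk_eq _ (union_subset hA hB), restrict_eRk_eq _ (inter_subset_left.trans hA),
    IsModularPair]

theorem of_indep_union (hI : N.IsBasis I F) (hIG : Disjoint I G) (h : N.Indep (I ∪ G)) :
    IsModularPair N F G := by
  refine of_le ?_
  have hIG_rank : N.eRk I + N.eRk G = N.eRk (I ∪ G) := by
    rw [hI.indep.eRk_eq_encard, (h.subset subset_union_right).eRk_eq_encard, h.eRk_eq_encard,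
      encard_union_eq hIG]
  rw [← hI.eRk_eq_eRk, hIG_rank]
  exact (N.eRk_mono (union_subset_union_left G hI.subset)).trans le_self_add

theorem of_eRk_le_two (hFE : F ⊆ N.E) (hF : N.eRk F ≤ 2) (hG : N.IsFlat G) {e : α}
    (he : N.IsNonloop e) (heFG : e ∈ F ∩ G) : IsModularPair N F G := by
  by_cases hFG : F ⊆ G
  · exact of_subset hFG
  obtain ⟨t, htF, htG⟩ := not_subset.1 hFG
  have hunion : N.eRk G + 1 ≤ N.eRk (F ∪ G) := by
    rw [← eRk_insert_eq_add_one ⟨hFE htF, by rwa [hG.closure]⟩]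
    exact N.eRk_mono (insert_subset (Or.inl htF) subset_union_right)
  have hinter : 1 ≤ N.eRk (F ∩ G) :=
    he.eRk_eq.symm.trans_le (N.eRk_mono (singleton_subset_iff.2 heFG))
  refine of_le ?_
  calc N.eRk F + N.eRk G ≤ 2 + N.eRk G := by gcongr
    _ = N.eRk G + 1 + 1 := by rw [add_comm, add_assoc, one_add_one_eq_two]
    _ ≤ N.eRk (F ∪ G) + N.eRk (F ∩ G) := add_le_add hunion hinter

variable [N.RankFinite]

theorem mono_left (h : IsModularPair N A B) (hS : A ∩ B ⊆ S) (hSA : S ⊆ A) :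
    IsModularPair N S B := by
  have hsub := N.eRk_inter_add_eRk_union_le A (S ∪ B)
  rw [inter_union_distrib_left, inter_eq_right.2 hSA, union_eq_left.2 hS, ← union_assoc,
    union_eq_left.2 hSA] at hsub
  have hSB : S ∩ B = A ∩ B :=
    (inter_subset_inter_left B hSA).antisymm (subset_inter hS inter_subset_right)
  refine of_le ?_
  rw [hSB]
  rw [IsModularPair] at h
  lift N.eRk to Set α → ℕ using fun X => (N.isRkFinite_set X).eRk_lt_top.ne with r
  norm_cast at *
  omega

theorem trans (hAB : IsModularPair N A B) (hK : IsModularPair N (A ∩ B) K) (hKB : K ⊆ B) :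
    IsModularPair N A K := by
  have hsub := N.eRk_inter_add_eRk_union_le (A ∪ K) B
  rw [union_inter_distrib_right, inter_eq_left.2 hKB, union_assoc, union_eq_right.2 hKB] at hsub
  rw [IsModularPair, inter_assoc, inter_eq_right.2 hKB] at hK
  refine of_le ?_
  rw [IsModularPair] at hAB
  lift N.eRk to Set α → ℕ using fun X => (N.isRkFinite_set X).eRk_lt_top.ne with r
  norm_cast at *
  omega

theorem closure_union_inter_subset (h : IsModularPair N A B) (hS : A ∩ B ⊆ S) (hSA : S ⊆ A)
    (hAE : A ⊆ N.E) (hBE : B ⊆ N.E) : N.closure (S ∪ B) ∩ A ⊆ N.closure S := by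
  set T := N.closure (S ∪ B) ∩ A
  have hSBE : S ∪ B ⊆ N.E := union_subset (hSA.trans hAE) hBE
  have hST : S ⊆ T := subset_inter (subset_union_left.trans (N.subset_closure _ hSBE)) hSA
  have hinter : T ∩ B = S ∩ B := by
    refine (subset_inter ?_ inter_subset_right).antisymm (inter_subset_inter_left B hST)
    exact (inter_subset_inter_left B inter_subset_right).trans hS
  have hunion : N.eRk (T ∪ B) = N.eRk (S ∪ B) := by
    refine le_antisymm ?_ (N.eRk_mono (union_subset_union_left B hST))
    rw [← N.eRk_closure_eq (S ∪ B)]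
    exact N.eRk_mono (union_subset inter_subset_left
      (subset_union_right.trans (N.subset_closure _ hSBE)))
  have hTB := h.mono_left (hS.trans hST) inter_subset_right
  rw [IsModularPair, hinter, hunion, ← h.mono_left hS hSA] at hTB
  have hrank : N.eRk T = N.eRk S :=
    ENat.add_left_injective_of_ne_top (N.isRkFinite_set B).eRk_lt_top.ne hTB
  rw [(N.isRkFinite_set S).closure_eq_closure_of_subset_of_eRk_ge_eRk hST hrank.le]
  exact N.subset_closure T (inter_subset_right.trans hAE)

theorem isFlat_of_isFlat_restrict (hAB : A ∪ B = N.E) (h : IsModularPair N A B)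
    (hmod : ∀ G, (N ↾ B).IsFlat G → IsModularPair N (A ∩ B) G) (hF : F ⊆ N.E)
    (hFA : (N ↾ A).IsFlat (F ∩ A)) (hFB : (N ↾ B).IsFlat (F ∩ B)) : N.IsFlat F := by
  have hA : A ⊆ N.E := hAB ▸ subset_union_left
  have hB : B ⊆ N.E := hAB ▸ subset_union_right
  have hFF : N.closure F = N.closure (F ∩ A ∪ F ∩ B) := by
    rw [← inter_union_distrib_left, hAB, inter_eq_left.2 hF]
  have hFcl : F ⊆ N.closure F := N.subset_closure F hF
  rw [isFlat_restrict_iff hA inter_subset_right] at hFA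
  have hclA : N.closure F ∩ A ⊆ F ∩ A := by
    have hpair := h.trans (hmod _ hFB) inter_subset_right
    have := hpair.closure_union_inter_subset (S := F ∩ A)
      (subset_inter (inter_subset_right.trans inter_subset_left) inter_subset_left)
      inter_subset_right hA (inter_subset_right.trans hB)
    rw [← hFF] at this
    exact (subset_inter this inter_subset_right).trans hFA.subset
  rw [isFlat_restrict_iff hB inter_subset_right] at hFB
  -- As `hclA` puts `A ∩ cl(F)` inside `F`, modularity of the trace of `cl(F)` on `B` finishes.
  have hclB : N.closure F ∩ B ⊆ F ∩ B := by
    have hpair := (h.trans (hmod _ (isFlat_restrict_inter (N.isFlat_closure F) hB))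
      inter_subset_right).mono_left (S := F ∩ A) (fun e he => hclA ⟨he.2.1, he.1⟩)
      inter_subset_right
    have := hpair.symm.closure_union_inter_subset (S := F ∩ B)
      (fun e he => ⟨he.2.1, he.1.2⟩) (inter_subset_inter_left B hFcl)
      (inter_subset_right.trans hB) (inter_subset_right.trans hA)
    rw [union_comm, ← hFF] at this
    exact (subset_inter (fun e he => this ⟨he.1, he⟩) inter_subset_right).trans hFB.subset
  rw [isFlat_iff_closure_eq]
  refine subset_antisymm ?_ hFcl
  rw [← inter_eq_left.2 (N.closure_subset_ground F), ← hAB, inter_union_distrib_left]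
  exact union_subset (hclA.trans inter_subset_left) (hclB.trans inter_subset_left)

theorem isGenParallelConnection (h : IsModularPair N A B) (hAB : A ∪ B = N.E)
    (hmod : (N ↾ B).IsModularFlat (A ∩ B)) :
    N.IsGenParallelConnection (A ∩ B) (N ↾ A) (N ↾ B) where
  inter_eq := rfl
  restrict_eq := by
    rw [restrict_restrict_eq _ inter_subset_left, restrict_restrict_eq _ inter_subset_right]
  modular := Or.inr (by
    rw [IsModularlyEmbedded, hmod.1.closure]
    exact ⟨hmod, fun e he => absurd he.1 he.2⟩)
  ground_eq := hAB.symm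
  isFlat_iff F hF := by
    refine ⟨fun hflat => ⟨isFlat_restrict_inter hflat (hAB ▸ subset_union_left),
      isFlat_restrict_inter hflat (hAB ▸ subset_union_right)⟩, fun hflat => ?_⟩
    refine h.isFlat_of_isFlat_restrict hAB (fun G hG => ?_) hF hflat.1 hflat.2
    exact (restrict_iff inter_subset_right hG.subset_ground).1 (hmod.2 G hG)

end IsModularPair

section GenParallelConnection

variable {α : Type*} {P M₁ M₂ : Matroid α} {T F : Set α}

theorem exists_isFlat_inter_ground_eq (hP : P.IsGenParallelConnection T M₁ M₂)
    (hF : M₁.IsFlat F) : ∃ G, P.IsFlat G ∧ G ∩ M₁.E = F := by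
  have hTE : M₁.E ∩ M₂.E = T := hP.inter_eq
  have hFE : F ⊆ M₁.E := hF.subset_ground
  set K := M₂.closure (F ∩ T)
  have hKE : K ⊆ M₂.E := M₂.closure_subset_ground _
  have hK_inter : K ∩ M₁.E ⊆ F := by
    have hKT : K ∩ T = F ∩ T := by
      rw [← isFlat_restrict_iff (hTE ▸ inter_subset_right) inter_subset_right, ← hP.restrict_eq]
      exact isFlat_restrict_inter hF (hTE ▸ inter_subset_left)
    exact fun e he => (hKT.subset ⟨he.1, hTE.subset ⟨he.2, hKE he.1⟩⟩).1
  have hF_inter : F ∩ M₂.E ⊆ K := fun e he =>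
    M₂.mem_closure_of_mem' ⟨he.1, hTE.subset ⟨hFE he.1, he.2⟩⟩ he.2
  have h₁ : (F ∪ K) ∩ M₁.E = F := by
    rw [union_inter_distrib_right, inter_eq_left.2 hFE, union_eq_left.2 hK_inter]
  have h₂ : (F ∪ K) ∩ M₂.E = K := by
    rw [union_inter_distrib_right, inter_eq_left.2 hKE, union_eq_right.2 hF_inter]
  refine ⟨F ∪ K, (hP.isFlat_iff _ ?_).2 ?_, h₁⟩
  · exact hP.ground_eq ▸ union_subset_union hFE hKE
  · rw [h₁, h₂]
    exact ⟨hF, M₂.isFlat_closure _⟩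

theorem restrict_ground_left_eq (hP : P.IsGenParallelConnection T M₁ M₂) : P ↾ M₁.E = M₁ := by
  have hE : M₁.E ⊆ P.E := hP.ground_eq ▸ subset_union_left
  refine eq_of_forall_isFlat_iff fun F => ⟨fun hF => ?_, fun hF => ?_⟩
  · rw [← (isFlat_restrict_iff hE hF.subset_ground).1 hF]
    exact ((hP.isFlat_iff _ (P.closure_subset_ground F)).1 (P.isFlat_closure F)).1
  · obtain ⟨G, hG, rfl⟩ := exists_isFlat_inter_ground_eq hP hF
    exact isFlat_restrict_inter hG hE

theorem delete_sdiff_eq_left (hP : P.IsGenParallelConnection T M₁ M₂) :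
    P ＼ (M₂.E \ T) = M₁ := by
  have hE : P.E \ (M₂.E \ T) = M₁.E := by
    rw [hP.ground_eq, ← hP.inter_eq]
    grind
  rw [delete_eq_restrict, hE, restrict_ground_left_eq hP]

end GenParallelConnection

section Coindependence

variable {α : Type*} {M : Matroid α} {A L : Set α} {n : ℕ} {x y : Fin n → α}

theorem eRk_closure_sdiff_le_eRk_dual [M.RankFinite] (hL : M.Indep L) :
    M.eRk (M.closure L \ L) ≤ M✶.eRk L := by
  have hLE := hL.subset_ground
  have hLcl := M.subset_closure L hLE
  have hsub := M.eRk_inter_add_eRk_union_le (M.closure L) (M.E \ L)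
  have hinter : M.closure L ∩ (M.E \ L) = M.closure L \ L := by
    rw [← inter_sdiff_assoc, inter_eq_left.2 (M.closure_subset_ground L)]
  have hunion : M.closure L ∪ M.E \ L = M.E := by
    rw [← union_eq_left.2 hLcl, union_assoc, union_sdiff_cancel hLE,
      union_eq_right.2 (M.closure_subset_ground L)]
  rw [hinter, hunion, eRk_ground, eRk_closure_eq, hL.eRk_eq_encard, add_comm L.encard,
    ← M.eRk_dual_add_eRank L hLE] at hsub
  exact (ENat.add_le_add_iff_right (M.eRank_ne_top_iff.2 inferInstance)).1 hsub

theorem coindep_of_isThreeConnected [M.RankFinite] (hM : M.IsThreeConnected) (hAE : A ⊆ M.E)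
    (hA : M.eRk A = 2) (hAc : 2 ≤ (M.E \ A).encard) : M.Coindep A := by
  rw [coindep_iff_compl_spanning, spanning_iff_eRk_le]
  by_contra! hlt
  refine hM 2 (by norm_num) (by norm_num) A ⟨hAE, hA.symm.trans_le (M.eRk_le_encard A), hAc, ?_⟩
  rw [hA, add_comm]
  exact (ENat.add_lt_add_iff_right (by simp)).2 hlt

theorem coindep_of_isCarambole [M.RankFinite] (hM : M.IsThreeConnected) (hK : M.IsCarambole x y)
    (hxy : Disjoint (range x) (range y)) (hx : 2 ≤ (range x).encard) : M.Coindep (range y) := by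
  have hxE : range x ⊆ M.E :=
    range_subset_iff.2 fun i => (hK.isCocircuit i).subset_ground (mem_insert _ _)
  exact coindep_of_isThreeConnected hM hK.contractible.1 hK.isLine.2
    (hx.trans (encard_mono (subset_sdiff.2 ⟨hxE, hxy⟩)))

end Coindependence

/-- The configuration of `x₁, …, xₙ, y₁, …, yₙ` that a carambole of `M` forms in `N = M✶`. It makes
the restriction of `N` to these elements a copy of `Θₙ`, see `IsThetaFrame.restrict_eq_thetaOn`. -/
structure IsThetaFrame {α : Type*} (N : Matroid α) {n : ℕ} (x y : Fin n → α) : Prop where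
  injective_y : Function.Injective y
  indep : N.Indep (range y)
  isCircuit : ∀ i, N.IsCircuit (insert (x i) (range y \ {y i}))
  eRk_range_x_le : N.eRk (range x) ≤ 2

namespace IsThetaFrame

variable {α : Type*} {N : Matroid α} {n : ℕ} {x y : Fin n → α} {i j s t u v : Fin n} {G R : Set α}

theorem disjoint (h : IsThetaFrame N x y) : Disjoint (range x) (range y) := by
  rw [Set.disjoint_left]
  rintro _ ⟨i, rfl⟩ hi
  exact (h.isCircuit i).not_indep (h.indep.subset (insert_subset hi sdiff_subset))

theorem x_ne_y (h : IsThetaFrame N x y) (i j : Fin n) : x i ≠ y j :=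
  h.disjoint.ne_of_mem (mem_range_self i) (mem_range_self j)

theorem range_x_subset_ground (h : IsThetaFrame N x y) : range x ⊆ N.E :=
  range_subset_iff.2 fun i => (h.isCircuit i).subset_ground (mem_insert _ _)

theorem ground_sdiff_inter (h : IsThetaFrame N x y) :
    (N.E \ range y) ∩ (range x ∪ range y) = range x := by
  rw [inter_union_distrib_left, sdiff_inter_self, union_empty]
  exact inter_eq_right.2 (subset_sdiff.2 ⟨h.range_x_subset_ground, h.disjoint⟩)

theorem ground_sdiff_union (h : IsThetaFrame N x y) :
    (N.E \ range y) ∪ (range x ∪ range y) = N.E := by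
  rw [union_left_comm, sdiff_union_of_subset h.indep.subset_ground]
  exact union_eq_right.2 h.range_x_subset_ground

theorem restrict (h : IsThetaFrame N x y) (hx : range x ⊆ R) (hy : range y ⊆ R) :
    IsThetaFrame (N ↾ R) x y where
  injective_y := h.injective_y
  indep := h.indep.indep_restrict_of_subset hy
  isCircuit i := (h.isCircuit i).isCircuit_restrict_of_subset
    (insert_subset (hx (mem_range_self i)) (sdiff_subset.trans hy))
  eRk_range_x_le := by
    rw [restrict_eRk_eq _ hx]
    exact h.eRk_range_x_le

theorem x_mem_closure (h : IsThetaFrame N x y) (i : Fin n) :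
    x i ∈ N.closure (range y \ {y i}) := by
  have hi : x i ∉ range y \ {y i} := fun hi => h.disjoint.notMem_of_mem_left (mem_range_self i) hi.1
  simpa only [insert_sdiff_self_of_notMem hi] using
    (h.isCircuit i).mem_closure_sdiff_singleton_of_mem (mem_insert (x i) _)

theorem range_x_subset_closure (h : IsThetaFrame N x y) : range x ⊆ N.closure (range y) :=
  range_subset_iff.2 fun i => N.closure_subset_closure sdiff_subset (h.x_mem_closure i)

theorem fundCircuit_eq (h : IsThetaFrame N x y) (i : Fin n) :
    N.fundCircuit (x i) (range y) = insert (x i) (range y \ {y i}) :=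
  ((h.isCircuit i).eq_fundCircuit_of_subset h.indep (insert_subset_insert sdiff_subset)).symm

theorem indep_insert (h : IsThetaFrame N x y) (hij : i ≠ j) :
    N.Indep (insert (x i) (range y \ {y j})) := by
  have hj : y j ∈ N.fundCircuit (x i) (range y) := by
    rw [h.fundCircuit_eq]
    exact mem_insert_of_mem _ ⟨mem_range_self j, h.injective_y.ne hij.symm⟩
  rw [insert_sdiff_singleton_comm (h.x_ne_y i j)]
  exact (h.indep.mem_fundCircuit_iff (h.range_x_subset_closure (mem_range_self i))
    (h.disjoint.notMem_of_mem_left (mem_range_self i))).1 hj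

theorem injective_x (h : IsThetaFrame N x y) : Function.Injective x := by
  intro i j hij
  by_contra hne
  refine (h.isCircuit i).not_indep ?_
  rw [hij]
  exact h.indep_insert (Ne.symm hne)

theorem injective_sumElim (h : IsThetaFrame N x y) : Function.Injective (Sum.elim x y) :=
  h.injective_x.sumElim h.injective_y h.x_ne_y

theorem indep_pair (h : IsThetaFrame N x y) (hst : s ≠ t) : N.Indep {x s, x t} := by
  have ht : N.Indep {x t} :=
    (h.indep_insert hst.symm).subset (singleton_subset_iff.2 (mem_insert _ _))
  have hs : x s ∉ N.closure (range y \ {y t}) :=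
    ((h.indep.sdiff _).notMem_closure_iff_of_notMem
      (fun hs => h.disjoint.notMem_of_mem_left (mem_range_self s) hs.1)
      (h.range_x_subset_ground (mem_range_self s))).2 (h.indep_insert hst)
  refine ht.insert_indep_iff.2 (Or.inl ⟨h.range_x_subset_ground (mem_range_self s), fun hst => ?_⟩)
  exact hs (N.closure_subset_closure_of_subset_closure
    (singleton_subset_iff.2 (h.x_mem_closure t)) hst)

theorem isBasis_pair (h : IsThetaFrame N x y) (hst : s ≠ t) :
    N.IsBasis {x s, x t} (range x) := by
  refine (h.indep_pair hst).isBasis_of_eRk_ge (toFinite _)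
    (pair_subset (mem_range_self s) (mem_range_self t)) ?_ h.range_x_subset_ground
  rw [(h.indep_pair hst).eRk_eq_encard, encard_pair (h.injective_x.ne hst)]
  exact h.eRk_range_x_le

theorem eRk_range_x (h : IsThetaFrame N x y) (hst : s ≠ t) : N.eRk (range x) = 2 := by
  rw [← (h.isBasis_pair hst).encard_eq_eRk, encard_pair (h.injective_x.ne hst)]

theorem encard_range_y (h : IsThetaFrame N x y) : (range y).encard = n := by
  rw [← image_univ, h.injective_y.encard_image, encard_univ, ENat.card_eq_coe_fintype_card,
    Fintype.card_fin]

theorem eRk_union (h : IsThetaFrame N x y) : N.eRk (range x ∪ range y) = n := by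
  rw [← h.encard_range_y, ← h.indep.eRk_eq_encard]
  refine le_antisymm ?_ (N.eRk_mono subset_union_right)
  rw [← N.eRk_closure_eq (range y)]
  exact N.eRk_mono (union_subset h.range_x_subset_closure
    (N.subset_closure _ h.indep.subset_ground))

theorem y_mem_closure (h : IsThetaFrame N x y) (huv : u ≠ v) :
    y u ∈ N.closure (range x ∪ y '' {u, v}ᶜ) := by
  refine N.closure_subset_closure ?_ ((h.isCircuit v).mem_closure_sdiff_singleton_of_mem (e := y u)
    (mem_insert_of_mem _ ⟨mem_range_self u, h.injective_y.ne huv⟩))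
  rintro _ ⟨rfl | ⟨⟨k, rfl⟩, hkv⟩, hku⟩
  · exact Or.inl (mem_range_self v)
  · refine Or.inr (mem_image_of_mem y ?_)
    rintro (rfl | rfl)
    · exact hku rfl
    · exact hkv rfl

theorem range_y_subset_closure (h : IsThetaFrame N x y) (huv : u ≠ v) :
    range y ⊆ N.closure (range x ∪ y '' {u, v}ᶜ) := by
  rintro _ ⟨k, rfl⟩
  by_cases hk : k ∈ ({u, v} : Set (Fin n))
  · obtain rfl | rfl := hk
    · exact h.y_mem_closure huv
    · rw [pair_comm]
      exact h.y_mem_closure huv.symm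
  · exact N.mem_closure_of_mem' (Or.inr (mem_image_of_mem y hk))
      (h.indep.subset_ground (mem_range_self k))

theorem indep_pair_union (h : IsThetaFrame N x y) (hst : s ≠ t) (huv : u ≠ v) :
    N.Indep ({x s, x t} ∪ y '' {u, v}ᶜ) := by
  have hZ : ({x s, x t} ∪ y '' {u, v}ᶜ).Finite := toFinite _
  refine (N.isRkFinite_of_finite hZ).indep_of_encard_le_eRk ?_
  calc ({x s, x t} ∪ y '' {u, v}ᶜ).encard
      ≤ ({x s, x t} : Set α).encard + (y '' {u, v}ᶜ).encard := encard_union_le _ _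
    _ = ({u, v} : Set (Fin n)).encard + ({u, v}ᶜ : Set (Fin n)).encard := by
      rw [encard_pair (h.injective_x.ne hst), encard_pair huv, h.injective_y.encard_image]
    _ = N.eRk (range y) := by
      rw [encard_add_encard_compl, ← h.injective_y.encard_image, image_univ,
        h.indep.eRk_eq_encard]
    _ ≤ N.eRk (range x ∪ y '' {u, v}ᶜ) := by
      rw [← N.eRk_closure_eq (range x ∪ _)]
      exact N.eRk_mono (h.range_y_subset_closure huv)
    _ = N.eRk ({x s, x t} ∪ y '' {u, v}ᶜ) := by
      rw [(h.isBasis_pair hst).eRk_eq_eRk_union]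

theorem thetaP_of_indep (h : IsThetaFrame N x y) {A B : Finset (Fin n)}
    (hI : N.Indep (x '' A ∪ y '' B)) : ThetaP A B := by
  refine ⟨?_, ?_, ?_⟩
  · have hA := (hI.subset subset_union_left).encard_le_eRk_of_subset (image_subset_range x A)
    rw [h.injective_x.encard_image, encard_coe_eq_coe_finsetCard] at hA
    exact_mod_cast hA.trans h.eRk_range_x_le
  · have hAB := hI.encard_le_eRk_of_subset
      (union_subset_union (image_subset_range x A) (image_subset_range y B))
    rw [h.eRk_union, encard_union_eq (h.disjoint.mono (image_subset_range x A)
      (image_subset_range y B)), h.injective_x.encard_image, h.injective_y.encard_image,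
      encard_coe_eq_coe_finsetCard, encard_coe_eq_coe_finsetCard] at hAB
    exact_mod_cast hAB
  · rintro i ⟨rfl, rfl⟩
    refine (h.isCircuit i).not_indep ?_
    rwa [Finset.coe_singleton, image_singleton, singleton_union, Finset.coe_compl,
      Finset.coe_singleton, image_compl_eq_range_sdiff_image h.injective_y, image_singleton] at hI

theorem indep_insert_image (h : IsThetaFrame N x y) {B : Finset (Fin n)} (hB : B.card < n)
    (hne : B ≠ {i}ᶜ) : N.Indep (insert (x i) (y '' B)) := by
  obtain ⟨j, hjB, hij⟩ : ∃ j, j ∉ B ∧ i ≠ j := by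
    by_contra! hall
    have hsub : {i}ᶜ ⊆ B := fun j hj => by
      by_contra hjB
      exact Finset.mem_compl.1 hj (Finset.mem_singleton.2 (hall j hjB).symm)
    have := theta_card_compl i
    exact hne (Finset.eq_of_subset_of_card_le hsub (by omega)).symm
  refine (h.indep_insert hij).subset (insert_subset_insert ?_)
  rintro _ ⟨k, hk, rfl⟩
  refine ⟨mem_range_self k, h.injective_y.ne ?_⟩
  rintro rfl
  exact hjB hk

theorem indep_pair_union_image (h : IsThetaFrame N x y) (hst : s ≠ t) {B : Finset (Fin n)}
    (hB : B.card + 2 ≤ n) : N.Indep ({x s, x t} ∪ y '' B) := by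
  have hBc : 1 < Bᶜ.card := by
    rw [Finset.card_compl, Fintype.card_fin]
    omega
  obtain ⟨u, v, hu, hv, huv⟩ := Finset.one_lt_card_iff.1 hBc
  refine (h.indep_pair_union hst huv).subset (union_subset_union_right _ (image_mono ?_))
  rintro b hb (rfl | rfl)
  · exact Finset.mem_compl.1 hu hb
  · exact Finset.mem_compl.1 hv hb

theorem indep_of_thetaP (h : IsThetaFrame N x y) {A B : Finset (Fin n)} (hAB : ThetaP A B) :
    N.Indep (x '' A ∪ y '' B) := by
  obtain ⟨hA, hcard, hne⟩ := hAB
  obtain hA₀ | hA₁ | hA₂ : A.card = 0 ∨ A.card = 1 ∨ A.card = 2 := by omega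
  · rw [Finset.card_eq_zero.1 hA₀, Finset.coe_empty, image_empty, empty_union]
    exact h.indep.subset (image_subset_range y B)
  · obtain ⟨i, rfl⟩ := Finset.card_eq_one.1 hA₁
    rw [Finset.coe_singleton, image_singleton, singleton_union]
    exact h.indep_insert_image (by omega) fun hB => hne i ⟨rfl, hB⟩
  · obtain ⟨s, t, hst, rfl⟩ := Finset.card_eq_two.1 hA₂
    rw [Finset.coe_pair, image_pair]
    exact h.indep_pair_union_image hst (by omega)

theorem indep_image_iff (h : IsThetaFrame N x y) (I : Set (Fin n ⊕ Fin n)) :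
    N.Indep (Sum.elim x y '' I) ↔ (theta n).Indep I := by
  classical
  have hI : Sum.elim x y '' I = x '' (Finset.univ.filter fun i => Sum.inl i ∈ I : Finset (Fin n)) ∪
      y '' (Finset.univ.filter fun i => Sum.inr i ∈ I : Finset (Fin n)) := by
    ext e
    simp
  rw [theta_indep_iff, thetaP_iff, hI]
  convert Iff.intro h.thetaP_of_indep h.indep_of_thetaP using 2

theorem restrict_eq_thetaOn (h : IsThetaFrame N x y) :
    N ↾ (range x ∪ range y) = thetaOn x y h.injective_sumElim := by
  refine ext_indep ?_ fun I hI => ?_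
  · simp [thetaOn, theta]
  · rw [restrict_ground_eq, ← Sum.elim_range] at hI
    obtain ⟨J, rfl⟩ := subset_range_iff_exists_image_eq.1 hI
    rw [← Sum.elim_range, restrict_indep_iff, and_iff_left hI, h.indep_image_iff, thetaOn,
      map_indep_iff]
    refine ⟨fun hJ => ⟨J, hJ, rfl⟩, fun ⟨K, hK, hJK⟩ => ?_⟩
    rwa [h.injective_sumElim.image_injective hJK]

theorem y_notMem_closure_range_x (h : IsThetaFrame N x y) (hn : 3 ≤ n) (i : Fin n) :
    y i ∉ N.closure (range x) := by
  obtain ⟨u, hui, -⟩ := Fin.exists_ne_and_ne_of_two_lt i i hn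
  obtain ⟨v, hvi, hvu⟩ := Fin.exists_ne_and_ne_of_two_lt i u hn
  rw [← (h.isBasis_pair hui).closure_eq_closure]
  have hi : y i ∈ {x u, x i} ∪ y '' {u, v}ᶜ := by
    refine Or.inr (mem_image_of_mem y ?_)
    rintro (rfl | rfl)
    · exact hui rfl
    · exact hvi rfl
  refine fun hcl => (h.indep_pair_union hui hvu.symm).notMem_closure_sdiff_of_mem hi
    (N.closure_subset_closure (subset_sdiff_singleton subset_union_left ?_) hcl)
  rintro (hiu | hii)
  · exact h.x_ne_y _ _ hiu.symm
  · exact h.x_ne_y _ _ hii.symm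

theorem isFlat_range_x (h : IsThetaFrame N x y) (hn : 3 ≤ n) (hE : N.E = range x ∪ range y) :
    N.IsFlat (range x) := by
  rw [isFlat_iff_closure_eq]
  refine subset_antisymm (fun e he => ?_) (N.subset_closure _ h.range_x_subset_ground)
  refine (hE.subset (N.closure_subset_ground _ he)).resolve_right ?_
  rintro ⟨i, rfl⟩
  exact h.y_notMem_closure_range_x hn i he

theorem exists_y_notMem (h : IsThetaFrame N x y) (hG : N.IsFlat G) (hi : x i ∉ G) :
    ∃ j ≠ i, y j ∉ G := by
  by_contra! hall
  refine hi (hG.closure.subset (N.closure_subset_closure ?_ (h.x_mem_closure i)))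
  rintro _ ⟨⟨j, rfl⟩, hj⟩
  refine hall j ?_
  rintro rfl
  exact hj rfl

theorem isModularPair_of_disjoint (h : IsThetaFrame N x y) (hst : s ≠ t)
    (hE : N.E = range x ∪ range y) (hG : N.IsFlat G) (hxG : Disjoint (range x) G) :
    IsModularPair N (range x) G := by
  have hGy : G ⊆ range y := fun e he =>
    (hE.subset (hG.subset_ground he)).resolve_left (hxG.notMem_of_mem_right he)
  have hx : ∀ i, x i ∉ G := fun i => hxG.notMem_of_mem_left (mem_range_self i)
  obtain ⟨u, -, hu⟩ := h.exists_y_notMem hG (hx s)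
  obtain ⟨v, hvu, hv⟩ := h.exists_y_notMem hG (hx u)
  have hGuv : G ⊆ y '' {u, v}ᶜ := fun e he => by
    obtain ⟨k, rfl⟩ := hGy he
    refine mem_image_of_mem y ?_
    rintro (rfl | rfl)
    · exact hu he
    · exact hv he
  exact .of_indep_union (h.isBasis_pair hst) (hxG.mono_left (h.isBasis_pair hst).subset)
    ((h.indep_pair_union hst hvu.symm).subset (union_subset_union_right _ hGuv))

theorem isModularFlat_range_x (h : IsThetaFrame N x y) (hn : 3 ≤ n)
    (hE : N.E = range x ∪ range y) : N.IsModularFlat (range x) := by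
  refine ⟨h.isFlat_range_x hn hE, fun G hG => ?_⟩
  by_cases hxG : Disjoint (range x) G
  · exact h.isModularPair_of_disjoint (s := ⟨0, by omega⟩) (t := ⟨1, by omega⟩) (by simp) hE hG hxG
  · obtain ⟨_, ⟨s, rfl⟩, hs⟩ := not_disjoint_iff.1 hxG
    obtain ⟨t, hts, -⟩ := Fin.exists_ne_and_ne_of_two_lt s s hn
    exact IsModularPair.of_eRk_le_two h.range_x_subset_ground h.eRk_range_x_le hG
      ((h.indep_pair hts).isNonloop_of_mem (by simp)) ⟨mem_range_self s, hs⟩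

theorem isModularPair_ground_sdiff (h : IsThetaFrame N x y) (hn : 2 ≤ n)
    (hr : N✶.eRk (range y) ≤ 2) :
    IsModularPair N (N.E \ range y) (range x ∪ range y) := by
  have hX : N.eRk (range x) = 2 := h.eRk_range_x (s := ⟨0, by omega⟩) (t := ⟨1, by omega⟩) (by simp)
  refine .of_le ?_
  rw [h.ground_sdiff_inter, h.ground_sdiff_union, h.eRk_union, hX, ← h.encard_range_y,
    ← N.eRk_dual_add_eRank _ h.indep.subset_ground, add_comm, eRk_ground]
  gcongr

variable [N.RankFinite]

theorem of_eRk_dual_le (hy : Function.Injective y) (hind : N.Indep (range y))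
    (hr : N✶.eRk (range y) ≤ 2) (hC : ∀ i, N.IsCircuit (insert (x i) (range y \ {y i}))) :
    IsThetaFrame N x y where
  injective_y := hy
  indep := hind
  isCircuit := hC
  eRk_range_x_le := by
    have hxcl : range x ⊆ N.closure (range y) \ range y := by
      rintro _ ⟨i, rfl⟩
      refine ⟨N.closure_subset_closure ?_
        ((hC i).mem_closure_sdiff_singleton_of_mem (mem_insert (x i) _)),
        fun hi => (hC i).not_indep (hind.subset (insert_subset hi sdiff_subset))⟩
      exact sdiff_singleton_subset_iff.2 (insert_subset_insert sdiff_subset)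
    exact (N.eRk_mono hxcl).trans ((eRk_closure_sdiff_le_eRk_dual hind).trans hr)

theorem isGenParallelConnection (h : IsThetaFrame N x y) (hn : 3 ≤ n)
    (hr : N✶.eRk (range y) ≤ 2) :
    N.IsGenParallelConnection (range x) (N ＼ range y) (thetaOn x y h.injective_sumElim) := by
  have hmod : (N ↾ (range x ∪ range y)).IsModularFlat (range x) :=
    (h.restrict subset_union_left subset_union_right).isModularFlat_range_x hn rfl
  have hP := (h.isModularPair_ground_sdiff (by omega) hr).isGenParallelConnection
    h.ground_sdiff_union (h.ground_sdiff_inter.symm ▸ hmod)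
  rwa [h.ground_sdiff_inter, h.restrict_eq_thetaOn, ← delete_eq_restrict] at hP

theorem eq_delete_iff (h : IsThetaFrame N x y) (hn : 3 ≤ n) (hr : N✶.eRk (range y) ≤ 2)
    {K : Matroid α} : K = N ＼ range y ↔
      N.IsGenParallelConnection (range x) K (thetaOn x y h.injective_sumElim) := by
  refine ⟨?_, fun hP => ?_⟩
  · rintro rfl
    exact h.isGenParallelConnection hn hr
  · have hy : (thetaOn x y h.injective_sumElim).E \ range x = range y := by
      rw [← h.restrict_eq_thetaOn, restrict_ground_eq, union_sdiff_left,
        h.disjoint.symm.sdiff_eq_left]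
    rw [← delete_sdiff_eq_left hP, hy]

end IsThetaFrame

theorem mainTheorem8_general {α : Type*} {n : ℕ} (x y : Fin n → α) (M H : Matroid α)
    [M✶.RankFinite]
    (hn : 3 ≤ n)
    (hy : Function.Injective y)
    (hind : M.Coindep (range y))
    (hr : M.eRk (range y) ≤ 2)
    (hC : ∀ i, M.IsCocircuit (insert (x i) (range y \ {y i}))) :
    ∃ hxy : Function.Injective (Sum.elim x y),
      (H = M.contract (range y) ↔
        M✶.IsGenParallelConnection (range x) H✶ (thetaOn x y hxy)) := by
  have hframe : IsThetaFrame M✶ x y :=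
    .of_eRk_dual_le hy hind.indep (by rwa [dual_dual]) fun i => (hC i).isCircuit
  refine ⟨hframe.injective_sumElim, ?_⟩
  rw [← hframe.eq_delete_iff hn (by rwa [dual_dual]), ← dual_contract, dual_inj]

theorem mainTheorem8 {α : Type*} {n : ℕ} (x y : Fin n → α) (M H : Matroid α)
    [M.Finite] [H.Finite]
    (hH : H.IsCosimple)
    (hXH : Set.range x ⊆ H.E)
    (hXr : H✶.eRk (Set.range x) = 2)
    (hLH : Disjoint (Set.range y) H.E)
    (hM : M.IsThreeConnected)
    (hMs : M.IsSimple)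
    (hK : M.IsCarambole x y) :
    ∃ hxy : Function.Injective (Sum.elim x y),
      (H = M.contract (Set.range y) ↔
        M✶.IsGenParallelConnection (Set.range x) H✶ (Matroid.thetaOn x y hxy)) :=
  have hxy : Disjoint (range x) (range y) := (hLH.mono_right hXH).symm
  have hx : 2 ≤ (range x).encard := hXr.symm.trans_le (H✶.eRk_le_encard _)
  mainTheorem8_general x y M H hK.three_le hK.injective
    (coindep_of_isCarambole hM hK hxy hx) hK.isLine.2.le hK.isCocircuit
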